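/- **Theorem 4.2.** Let $\tau_0\in\mathbb R$ and let $\Phi=\{\Phi_k\}_{k=0,1,2,\dots}$ be real polynomials with $\deg\Phi_k=k$ and $\Phi_k(\tau_0)=1$; write $\Phi_k(t)=p_{k0}+p_{k1}t+\dots+p_{kk}t^k$. Let $a\le b$ be real numbers. *Linear programming bound.* For a natural number $N$ put $$LP_N(\Phi,[a,b])=1+\inf\Big\{f_1+\dots+f_N:\ f_k\ge 0,\ \sum_{k=1}^N f_k\Phi_k(t)\le -1\ \text{ for all } t\in[a,b]\Big\}$$ (with $\inf\emptyset=+\infty$), and let Delsarte's linear programming bound be $LP(\Phi,[a,b])=\inf_N LP_N(\Phi,[a,b])$. *Semidefinite bound.* For $m\ge 1$ and $x=(x_1,\dots,x_{2m-1})\in\mathbb R^{2m-1}$ put $x_0=1$ and let $\bar H_m(x,[a,b])$ be the block diagonal matrix with the three $m\times m$ diagonal blocks $$(x_{i+j})_{0\le i,j<m},\qquad (x_{i+j+1}-a\,x_{i+j})_{0\le i,j<m},\qquad (b\,x_{i+j}-x_{i+j+1})_{0\le i,j<m}.$$ Let $y^*(m)$ be the infimum of the real numbers $y$ for which there is $x\in\mathbb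 R^{2m-1}$ with $$y+\sum_{i=1}^k p_{ki}x_i\ge -p_{k0}\quad (k=1,\dots,2m-1),\qquad \bar H_m(x,[a,b])\succeq 0.$$ Put $SDP_0(\Phi,[a,b],m)=\dfrac{1+y^*(m)}{y^*(m)}$ if $y^*(m)>0$, and $SDP_0(\Phi,[a,b],m)=+\infty$ otherwise, and let $SDP_0(\Phi,[a,b])=\inf_{m\ge1}SDP_0(\Phi,[a,b],m)$. Then $$SDP_0(\Phi,[a,b])=LP(\Phi,[a,b]).$$ Moreover, $SDP_0(\Phi,[a,b],m)=LP_{2m-1}(\Phi,[a,b])$ for every $m\ge1$. -/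

import Mathlib

open Polynomial

noncomputable section

namespace DelsarteSDP

/-- The `m × m` Hankel matrix `R_m = (s_{i+j})`, rows and columns numbered from `0`. -/
def hankelR (m : ℕ) (s : ℕ → ℝ) : Matrix (Fin m) (Fin m) ℝ :=
  Matrix.of fun i j => s (i + j)

/-- The matrix `F_m^+(a) = (s_{i+j+1} - a s_{i+j})`. -/
def hankelFplus (m : ℕ) (s : ℕ → ℝ) (a : ℝ) : Matrix (Fin m) (Fin m) ℝ :=
  Matrix.of fun i j => s (i + j + 1) - a * s (i + j)

/-- The matrix `F_m^-(b) = (b s_{i+j} - s_{i+j+1})`. -/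
def hankelFminus (m : ℕ) (s : ℕ → ℝ) (b : ℝ) : Matrix (Fin m) (Fin m) ℝ :=
  Matrix.of fun i j => b * s (i + j) - s (i + j + 1)

/-- The block diagonal matrix `H_m(s_0, …, s_{2m-1}, [a,b])` with diagonal blocks
`R_m`, `F_m^+(a)`, `F_m^-(b)`. Only the entries `s_0, …, s_{2m-1}` of `s` occur in it. -/
def hankelH (m : ℕ) (s : ℕ → ℝ) (a b : ℝ) :
    Matrix (Fin m ⊕ (Fin m ⊕ Fin m)) (Fin m ⊕ (Fin m ⊕ Fin m)) ℝ :=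
  Matrix.fromBlocks (hankelR m s) 0 0
    (Matrix.fromBlocks (hankelFplus m s a) 0 0 (hankelFminus m s b))

/-- The sequence `1, x_1, …, x_n` (followed by zeros, which are never used below);
`x_i` is stored as `x ⟨i - 1, _⟩`. -/
def powerSumSeq {n : ℕ} (x : Fin n → ℝ) : ℕ → ℝ
  | 0 => 1
  | k + 1 => if h : k < n then x ⟨k, h⟩ else 0

/-- The normalized matrix
`H̄_m(x_1, …, x_{2m-1}, [a,b]) = H_m(1, x_1, …, x_{2m-1}, [a,b])`. -/
def hankelHbar (m : ℕ) (x : Fin (2 * m - 1) → ℝ) (a b : ℝ) :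
    Matrix (Fin m ⊕ (Fin m ⊕ Fin m)) (Fin m ⊕ (Fin m ⊕ Fin m)) ℝ :=
  hankelH m (powerSumSeq x) a b

/-- `(y, x_1, …, x_{2m-1})` is a feasible point of the semidefinite program with parameter `m`. -/
structure SDP0Feasible (Φ : ℕ → ℝ[X]) (a b : ℝ) (m : ℕ) (y : ℝ) (x : Fin (2 * m - 1) → ℝ) :
    Prop where
  linear : ∀ k ∈ Finset.Icc 1 (2 * m - 1),
    y + ∑ i ∈ Finset.Icc 1 k, (Φ k).coeff i * powerSumSeq x i ≥ -(Φ k).coeff 0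
  psd : (hankelHbar m x a b).PosSemidef

/-- The optimal value `y*(m)` of the semidefinite program with parameter `m`. -/
def sdp0Value (Φ : ℕ → ℝ[X]) (a b : ℝ) (m : ℕ) : EReal :=
  ⨅ (y : ℝ) (_ : ∃ x : Fin (2 * m - 1) → ℝ, SDP0Feasible Φ a b m y x), (y : EReal)

open Classical in
/-- The bound given by the semidefinite program with parameter `m`, namely `(1 + y*) / y*`.
A code with more than one point gives a feasible point with `y = 1 / (|C| - 1) > 0`, so the
inequality `y ≥ y*` bounds `|C|` only if `y* > 0`; otherwise the bound is `+∞`. -/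
def sdp0BoundAt (Φ : ℕ → ℝ[X]) (a b : ℝ) (m : ℕ) : EReal :=
  if 0 < sdp0Value Φ a b m then (1 + sdp0Value Φ a b m) / sdp0Value Φ a b m else ⊤

/-- The bound `SDP₀(Φ, [a,b])`: the best of the bounds over all natural numbers `m ≥ 1`. -/
def sdp0Bound (Φ : ℕ → ℝ[X]) (a b : ℝ) : EReal :=
  ⨅ (m : ℕ) (_ : 1 ≤ m), sdp0BoundAt Φ a b m

/-- `f_1, …, f_N` is a feasible point of the (dual) Delsarte linear program on `[a,b]`;
`f_k` is stored as `f ⟨k - 1, _⟩`. -/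
structure LPFeasible (Φ : ℕ → ℝ[X]) (a b : ℝ) (N : ℕ) (f : Fin N → ℝ) : Prop where
  nonneg : ∀ k, 0 ≤ f k
  le_neg_one : ∀ t ∈ Set.Icc a b, ∑ k : Fin N, f k * (Φ (k + 1)).eval t ≤ -1

/-- The linear programming bound with the number `N` fixed: one plus the infimum of
`f_1 + … + f_N` (`+∞` if there is no feasible point). -/
def lpBoundAt (Φ : ℕ → ℝ[X]) (a b : ℝ) (N : ℕ) : EReal :=
  1 + ⨅ (f : Fin N → ℝ) (_ : LPFeasible Φ a b N f), ((∑ k, f k : ℝ) : EReal)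

/-- Delsarte's linear programming bound `LP(Φ, [a,b]) = 1 + A*`, where `A*` is the infimum of
`f_1 + … + f_N` over all `N` and all feasible `f_1, …, f_N`. -/
def lpBound (Φ : ℕ → ℝ[X]) (a b : ℝ) : EReal :=
  1 + ⨅ (N : ℕ) (f : Fin N → ℝ) (_ : LPFeasible Φ a b N f), ((∑ k, f k : ℝ) : EReal)

end DelsarteSDP

end

namespace DelsarteSDP

/-! The two programs are dual, with optimal values reciprocal to each other. A point `x` satisfying
the matrix inequality is a functional `L` with `L 1 = 1`, and by a Markov–Lukács argument
(`momentFunctional_nonneg`) `L` is nonnegative on every polynomial of degree below `2m` that is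
nonnegative on `[a, b]`. Applying `L` to `-1 - ∑ f_k Φ_k` gives `1 ≤ y ∑ f_k`. Conversely, if `0 < c
< y*`, the convex hull of the curve `(Φ_k t)_k` misses an open orthant, and the separating
functional, rescaled, is LP-feasible with sum `1/c` (`exists_lpFeasible`). Only the inclusion of
point masses in the matrix-feasible set is needed here. Hence the LP infimum is `1/y*`, and `1 +
1/y* = (1 + y*)/y*`; if `y* ≤ 0`, the LP is infeasible. Padding `f` by zeros gives the statement
about infima. -/

/-! ### Moment functionals and the Hankel blocks -/

/-- The linear functional on polynomials with moments `s`, sending `X ^ k` to `s k`. -/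
noncomputable def momentFunctional (s : ℕ → ℝ) : ℝ[X] →ₗ[ℝ] ℝ :=
  Polynomial.lsum fun k => s k • LinearMap.id

theorem momentFunctional_eq_sum_range {s : ℕ → ℝ} {p : ℝ[X]} {n : ℕ} (hp : p.natDegree < n) :
    momentFunctional s p = ∑ i ∈ Finset.range n, p.coeff i * s i := by
  have h : momentFunctional s p = p.sum fun k c => s k * c := rfl
  rw [h, Polynomial.sum_over_range' p (fun _ => mul_zero _) n hp]
  exact Finset.sum_congr rfl fun i _ => mul_comm _ _

theorem momentFunctional_X_pow (s : ℕ → ℝ) (k : ℕ) : momentFunctional s (X ^ k) = s k := by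
  rw [momentFunctional_eq_sum_range (n := k + 1) (by simp), Finset.sum_range_succ]
  rw [Finset.sum_eq_zero]
  · simp
  · intro i hi
    rw [Polynomial.coeff_X_pow, if_neg (Finset.mem_range.1 hi).ne, zero_mul]

theorem momentFunctional_C_mul (s : ℕ → ℝ) (c : ℝ) (p : ℝ[X]) :
    momentFunctional s (C c * p) = c * momentFunctional s p := by
  rw [← smul_eq_C_mul, map_smul, smul_eq_mul]

/-- A functional whose `w`-localized Hankel matrix is positive semidefinite is nonnegative on
`w * q ^ 2`. -/
theorem map_mul_sq_nonneg {m : ℕ} (L : ℝ[X] →ₗ[ℝ] ℝ) (w : ℝ[X])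
    (M : Matrix (Fin m) (Fin m) ℝ) (hM : M.PosSemidef)
    (hL : ∀ i j : Fin m, M i j = L (w * X ^ ((i : ℕ) + j))) (q : ℝ[X]) (hq : q.natDegree < m) :
    0 ≤ L (w * q ^ 2) := by
  have h := hM.dotProduct_mulVec_nonneg (fun i : Fin m => q.coeff i)
  have hqs : q = ∑ i : Fin m, C (q.coeff i) * X ^ (i : ℕ) := by
    conv_lhs => rw [q.as_sum_range_C_mul_X_pow' hq]
    rw [Finset.sum_range]
  have hexp : w * q ^ 2 =
      ∑ i : Fin m, ∑ j : Fin m, (q.coeff i * q.coeff j) • (w * X ^ ((i : ℕ) + j)) := by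
    conv_lhs => rw [hqs, sq, Finset.sum_mul_sum, Finset.mul_sum]
    refine Finset.sum_congr rfl fun i _ => ?_
    rw [Finset.mul_sum]
    refine Finset.sum_congr rfl fun j _ => ?_
    rw [smul_eq_C_mul, C_mul, pow_add]
    ring
  rw [hexp]
  simp only [map_sum, map_smul, smul_eq_mul, ← hL]
  refine h.trans_eq ?_
  simp only [dotProduct, Matrix.mulVec, Pi.star_apply, star_trivial, Finset.mul_sum]
  refine Finset.sum_congr rfl fun i _ => Finset.sum_congr rfl fun j _ => ?_
  ring

theorem posSemidef_fromBlocks_diagonal {m n : Type*} [Fintype m] [Fintype n]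
    {A : Matrix m m ℝ} {D : Matrix n n ℝ} (hA : A.PosSemidef) (hD : D.PosSemidef) :
    (Matrix.fromBlocks A 0 0 D).PosSemidef := by
  refine Matrix.PosSemidef.of_dotProduct_mulVec_nonneg ?_ fun x => ?_
  · exact Matrix.IsHermitian.fromBlocks hA.1 (by simp) hD.1
  · have h₁ := hA.dotProduct_mulVec_nonneg (x ∘ Sum.inl)
    have h₂ := hD.dotProduct_mulVec_nonneg (x ∘ Sum.inr)
    rw [Matrix.fromBlocks_mulVec]
    simp only [dotProduct, Fintype.sum_sum_type, Sum.elim_inl, Sum.elim_inr, Matrix.zero_mulVec,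
      add_zero, zero_add, Pi.star_apply, Function.comp_apply] at h₁ h₂ ⊢
    exact add_nonneg h₁ h₂

theorem posSemidef_hankelH_iff {m : ℕ} {s : ℕ → ℝ} {a b : ℝ} :
    (hankelH m s a b).PosSemidef ↔ (hankelR m s).PosSemidef ∧ (hankelFplus m s a).PosSemidef ∧
      (hankelFminus m s b).PosSemidef := by
  refine ⟨fun h => ⟨h.submatrix Sum.inl, h.submatrix (Sum.inr ∘ Sum.inl),
    h.submatrix (Sum.inr ∘ Sum.inr)⟩, fun h => ?_⟩
  exact posSemidef_fromBlocks_diagonal h.1 (posSemidef_fromBlocks_diagonal h.2.1 h.2.2)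

theorem hankelR_nonneg {m : ℕ} {s : ℕ → ℝ} (h : (hankelR m s).PosSemidef) {q : ℝ[X]}
    (hq : q.natDegree < m) : 0 ≤ momentFunctional s (q ^ 2) := by
  have := map_mul_sq_nonneg (momentFunctional s) 1 _ h
    (fun i j => by rw [one_mul, momentFunctional_X_pow]; rfl) q hq
  rwa [one_mul] at this

theorem hankelFplus_nonneg {m : ℕ} {s : ℕ → ℝ} {a : ℝ} (h : (hankelFplus m s a).PosSemidef)
    {q : ℝ[X]} (hq : q.natDegree < m) : 0 ≤ momentFunctional s ((X - C a) * q ^ 2) := by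
  refine map_mul_sq_nonneg (momentFunctional s) _ _ h (fun i j => ?_) q hq
  rw [sub_mul, ← pow_succ', map_sub, momentFunctional_C_mul, momentFunctional_X_pow,
    momentFunctional_X_pow]
  rfl

theorem hankelFminus_nonneg {m : ℕ} {s : ℕ → ℝ} {b : ℝ} (h : (hankelFminus m s b).PosSemidef)
    {q : ℝ[X]} (hq : q.natDegree < m) : 0 ≤ momentFunctional s ((C b - X) * q ^ 2) := by
  refine map_mul_sq_nonneg (momentFunctional s) _ _ h (fun i j => ?_) q hq
  rw [sub_mul, ← pow_succ', map_sub, momentFunctional_C_mul, momentFunctional_X_pow,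
    momentFunctional_X_pow]
  rfl

theorem natDegree_X_sub_C_pow_mul_le (a : ℝ) (k : ℕ) (q : ℝ[X]) :
    ((X - C a) ^ k * q).natDegree ≤ k + q.natDegree := by
  refine natDegree_mul_le.trans ?_
  rw [natDegree_pow, natDegree_X_sub_C, mul_one]

theorem natDegree_C_sub_X_pow_mul_le (b : ℝ) (k : ℕ) (q : ℝ[X]) :
    ((C b - X) ^ k * q).natDegree ≤ k + q.natDegree := by
  have h : (C b - X : ℝ[X]) = -(X - C b) := by ring
  refine natDegree_mul_le.trans ?_
  rw [natDegree_pow, h, natDegree_neg, natDegree_X_sub_C, mul_one]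

/-- Even powers of `X - a` and `b - X` are absorbed into the square, so the parities of `i` and `j`
select the block. -/
theorem momentFunctional_pow_mul_pow_mul_sq_nonneg {m : ℕ} {s : ℕ → ℝ} {a b : ℝ} (hab : a < b)
    (h : (hankelH m s a b).PosSemidef) (i j : ℕ) (q : ℝ[X])
    (hij : i + j + 2 * q.natDegree < 2 * m) :
    0 ≤ momentFunctional s ((X - C a) ^ i * (C b - X) ^ j * q ^ 2) := by
  obtain ⟨hR, hp, hm⟩ := posSemidef_hankelH_iff.1 h
  have key : ∀ k l : ℕ, ((X - C a) ^ k * ((C b - X) ^ l * q)).natDegree ≤ k + (l + q.natDegree) :=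
    fun k l => (natDegree_X_sub_C_pow_mul_le a k _).trans
      (Nat.add_le_add_left (natDegree_C_sub_X_pow_mul_le b l q) k)
  rcases Nat.even_or_odd' i with ⟨k, rfl | rfl⟩ <;> rcases Nat.even_or_odd' j with ⟨l, rfl | rfl⟩
  · have := hankelR_nonneg hR (lt_of_le_of_lt (key k l) (by omega))
    convert this using 2
    ring
  · have := hankelFminus_nonneg hm (lt_of_le_of_lt (key k l) (by omega))
    convert this using 2
    ring
  · have := hankelFplus_nonneg hp (lt_of_le_of_lt (key k l) (by omega))
    convert this using 2
    ring
  -- No block carries the weight `(X - a)(b - X)`; multiplied by `b - a = (X - a) + (b - X)` it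
  -- splits into terms for `F⁻` and `F⁺`.
  · have h₁ := hankelFminus_nonneg hm (lt_of_le_of_lt (key (k + 1) l) (by omega))
    have h₂ := hankelFplus_nonneg hp (lt_of_le_of_lt (key k (l + 1)) (by omega))
    refine nonneg_of_mul_nonneg_right ?_ (sub_pos.2 hab)
    rw [← momentFunctional_C_mul]
    have h₃ := add_nonneg h₁ h₂
    rw [← map_add] at h₃
    convert h₃ using 2
    rw [C_sub]
    ring

/-! ### Polynomials nonnegative on an interval -/

/-- A polynomial that is nonnegative on `[a, b]` except possibly at one point is nonnegative on
`[a, b]`. -/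
theorem eval_nonneg_of_forall_ne {a b r : ℝ} (hab : a < b) {q : ℝ[X]}
    (h : ∀ t ∈ Set.Icc a b, t ≠ r → 0 ≤ q.eval t) : ∀ t ∈ Set.Icc a b, 0 ≤ q.eval t := by
  intro t ht
  by_contra! hlt
  have hopen : IsOpen {x : ℝ | q.eval x < 0} := isOpen_lt q.continuous continuous_const
  have htc : t ∈ closure (Set.Ioo a b) := by rwa [closure_Ioo hab.ne]
  obtain ⟨x, hx, hxab⟩ := mem_closure_iff.1 htc _ hopen hlt
  have hopen' : IsOpen ({x : ℝ | q.eval x < 0} ∩ Set.Ioo a b) := hopen.inter isOpen_Ioo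
  obtain ⟨y, hy, hyr⟩ := (dense_compl_singleton r).inter_open_nonempty _ hopen' ⟨x, hx, hxab⟩
  exact absurd (h y (Set.Ioo_subset_Icc_self hy.2) hyr) (not_le.2 hy.1)

/-- If `(X - r) * q` is nonnegative on `[a, b]` and `r` is an interior point, then `q r = 0`. -/
theorem eval_eq_zero_of_interior {a b r : ℝ} (hr : r ∈ Set.Ioo a b) {q : ℝ[X]}
    (h : ∀ t ∈ Set.Icc a b, 0 ≤ (t - r) * q.eval t) : q.eval r = 0 := by
  apply le_antisymm
  · have : ∀ t ∈ Set.Icc a r, 0 ≤ (-q).eval t := by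
      refine eval_nonneg_of_forall_ne (r := r) hr.1 fun t ht htr => ?_
      have htr' : t < r := lt_of_le_of_ne ht.2 htr
      have := h t ⟨ht.1, ht.2.trans hr.2.le⟩
      rw [eval_neg]
      nlinarith
    have := this r ⟨hr.1.le, le_rfl⟩
    rw [eval_neg] at this
    linarith
  · refine eval_nonneg_of_forall_ne (r := r) hr.2 (fun t ht htr => ?_) r ⟨le_rfl, hr.2.le⟩
    have htr' : r < t := lt_of_le_of_ne ht.1 (Ne.symm htr)
    have := h t ⟨hr.1.le.trans ht.1, ht.2⟩
    exact nonneg_of_mul_nonneg_right this (sub_pos.2 htr')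

/-- The inductive step of the Markov–Lukács argument: a functional that is nonnegative on the
products `(t - a) ^ i (b - t) ^ j q ^ 2` of bounded degree stays so after multiplication with a
polynomial that is nonnegative on `[a, b]`. -/
theorem map_mul_nonneg_of_nonneg_on_Icc {a b : ℝ} (hab : a < b) (L : ℝ[X] →ₗ[ℝ] ℝ) (N : ℕ)
    (hL : ∀ (i j : ℕ) (q : ℝ[X]), i + j + 2 * q.natDegree ≤ N →
      0 ≤ L ((X - C a) ^ i * (C b - X) ^ j * q ^ 2)) (n : ℕ) :
    ∀ p : ℝ[X], p.natDegree ≤ n → (∀ t ∈ Set.Icc a b, 0 ≤ p.eval t) →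
      ∀ (i j : ℕ) (q : ℝ[X]), i + j + 2 * q.natDegree + n ≤ N →
        0 ≤ L ((X - C a) ^ i * (C b - X) ^ j * q ^ 2 * p) := by
  induction n using Nat.strong_induction_on with
  | _ n ih =>
  intro p hpn hp i j q hN
  have hbase := hL i j q (by omega)
  have hconst : ∀ c : ℝ, 0 ≤ c → 0 ≤ L ((X - C a) ^ i * (C b - X) ^ j * q ^ 2 * C c) := by
    intro c hc
    rw [mul_comm, ← smul_eq_C_mul, map_smul]
    exact mul_nonneg hc hbase
  -- Split off the minimum `p r ≥ 0`; the rest vanishes at `r`. Its factor there raises `i` if `r =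
  -- a`, raises `j` if `r = b`, and is a square absorbed by `q` if `r` is interior.
  obtain ⟨r, hr, hmin⟩ := isCompact_Icc.exists_isMinOn (Set.nonempty_Icc.2 hab.le)
    (p.continuous.continuousOn (s := Set.Icc a b))
  obtain ⟨p', hp'⟩ : X - C r ∣ p - C (p.eval r) := by
    rw [dvd_iff_isRoot]
    simp [IsRoot]
  have hpe : p = C (p.eval r) + (X - C r) * p' := by rw [← hp']; ring
  have hnn : ∀ t ∈ Set.Icc a b, 0 ≤ (t - r) * p'.eval t := by
    intro t ht
    have h₁ := congrArg (eval t) hp'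
    simp only [eval_sub, eval_C, eval_mul, eval_X] at h₁
    rw [← h₁]
    exact sub_nonneg.2 (hmin ht)
  rcases eq_or_ne p' 0 with h0 | h0
  · rw [hpe, h0, mul_zero, add_zero]
    exact hconst _ (hp r hr)
  have hdeg : p'.natDegree + 1 ≤ n := by
    have h₁ : ((X - C r) * p').natDegree = 1 + p'.natDegree := by
      rw [natDegree_mul (X_sub_C_ne_zero r) h0, natDegree_X_sub_C]
    rw [← hp', natDegree_sub_C] at h₁
    omega
  rw [hpe, mul_add, map_add]
  refine add_nonneg (hconst _ (hp r hr)) ?_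
  rcases eq_or_lt_of_le hr.1 with rfl | har
  · have hp'nn : ∀ t ∈ Set.Icc a b, 0 ≤ p'.eval t :=
      eval_nonneg_of_forall_ne (r := a) hab fun t ht hta =>
        nonneg_of_mul_nonneg_right (hnn t ht) (sub_pos.2 (lt_of_le_of_ne ht.1 (Ne.symm hta)))
    have := ih (n - 1) (by omega) p' (by omega) hp'nn (i + 1) j q (by omega)
    refine this.trans_eq (congrArg L ?_)
    ring
  rcases eq_or_lt_of_le hr.2 with rfl | hrb
  · have hp'nn : ∀ t ∈ Set.Icc a r, 0 ≤ (-p').eval t :=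
      eval_nonneg_of_forall_ne (r := r) hab fun t ht htb => by
        have h₁ := hnn t ht
        have h₂ : t < r := lt_of_le_of_ne ht.2 htb
        rw [eval_neg]
        nlinarith
    have := ih (n - 1) (by omega) (-p') (by rw [natDegree_neg]; omega) hp'nn i (j + 1) q (by omega)
    refine this.trans_eq (congrArg L ?_)
    ring
  · obtain ⟨p'', hp''⟩ : X - C r ∣ p' :=
      dvd_iff_isRoot.2 (eval_eq_zero_of_interior ⟨har, hrb⟩ hnn)
    have h0' : p'' ≠ 0 := by
      rintro rfl
      exact h0 (by rw [hp'', mul_zero])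
    have hdeg' : p'.natDegree = 1 + p''.natDegree := by
      rw [hp'', natDegree_mul (X_sub_C_ne_zero r) h0', natDegree_X_sub_C]
    have hp''nn : ∀ t ∈ Set.Icc a b, 0 ≤ p''.eval t :=
      eval_nonneg_of_forall_ne (r := r) hab fun t ht htr => by
        have h₁ := hnn t ht
        rw [hp'', eval_mul, eval_sub, eval_X, eval_C, ← mul_assoc] at h₁
        exact nonneg_of_mul_nonneg_right h₁ (mul_self_pos.2 (sub_ne_zero.2 htr))
    have hq := natDegree_X_sub_C_pow_mul_le r 1 q
    have := ih (n - 2) (by omega) p'' (by omega) hp''nn i j ((X - C r) ^ 1 * q) (by omega)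
    refine this.trans_eq (congrArg L ?_)
    rw [hp'']
    ring

/-- For a degenerate interval the matrix inequality forces the moments of a point mass. -/
theorem moments_eq_pow_of_degenerate {m : ℕ} {s : ℕ → ℝ} {a : ℝ} (h0 : s 0 = 1)
    (h : (hankelH m s a a).PosSemidef) : ∀ k < 2 * m, s k = a ^ k := by
  obtain ⟨-, hp, hm⟩ := posSemidef_hankelH_iff.1 h
  -- Both a matrix and its negative are positive semidefinite, so it vanishes, which is the
  -- recurrence `s (k + 1) = a * s k`.
  have hneg : hankelFminus m s a = -hankelFplus m s a := by
    ext i j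
    simp [hankelFminus, hankelFplus]
  rw [hneg] at hm
  have hzero : hankelFplus m s a = 0 := by
    open scoped MatrixOrder in
    exact le_antisymm (by rw [Matrix.le_iff, zero_sub]; exact hm) (Matrix.nonneg_iff_posSemidef.2 hp)
  intro k
  induction k with
  | zero => intro; rw [h0, pow_zero]
  | succ k ih =>
    intro hk
    have h₁ := congrFun (congrFun hzero ⟨k / 2, by omega⟩) ⟨k - k / 2, by omega⟩
    simp only [hankelFplus, Matrix.of_apply, Matrix.zero_apply,
      Nat.add_sub_cancel' (Nat.div_le_self k 2)] at h₁
    rw [sub_eq_zero.1 h₁, ih (by omega), pow_succ']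

/-- Truncated moment sequences on `[a, b]` define functionals that are nonnegative on the
polynomials of degree less than `2 m` that are nonnegative on `[a, b]`. -/
theorem momentFunctional_nonneg {m : ℕ} {s : ℕ → ℝ} {a b : ℝ} (hab : a ≤ b) (h0 : s 0 = 1)
    (h : (hankelH m s a b).PosSemidef) {p : ℝ[X]} (hdeg : p.natDegree < 2 * m)
    (hp : ∀ t ∈ Set.Icc a b, 0 ≤ p.eval t) : 0 ≤ momentFunctional s p := by
  rcases hab.eq_or_lt with rfl | hab
  · have hs := moments_eq_pow_of_degenerate h0 h
    rw [momentFunctional_eq_sum_range hdeg,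
      Finset.sum_congr rfl fun i hi => by rw [hs i (Finset.mem_range.1 hi)],
      ← eval_eq_sum_range' hdeg]
    exact hp a ⟨le_rfl, le_rfl⟩
  · have := map_mul_nonneg_of_nonneg_on_Icc hab (momentFunctional s) (2 * m - 1)
      (fun i j q hq => momentFunctional_pow_mul_pow_mul_sq_nonneg hab h i j q (by omega))
      p.natDegree p le_rfl hp 0 0 1 (by simp; omega)
    simpa using this

/-! ### Point masses and convex combinations -/

/-- Each block is the rank-one matrix `v vᵀ`, `v = (t ^ i)`, scaled by `1`, `t - a` or `b - t`. -/
theorem posSemidef_hankelH_pow {a b t : ℝ} (ht : t ∈ Set.Icc a b) {m : ℕ} {s : ℕ → ℝ}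
    (hs : ∀ k < 2 * m, s k = t ^ k) : (hankelH m s a b).PosSemidef := by
  have hv := Matrix.posSemidef_vecMulVec_self_star (fun i : Fin m => t ^ (i : ℕ))
  refine posSemidef_hankelH_iff.2 ⟨?_, ?_, ?_⟩
  · convert hv using 1
    ext i j
    simp [hankelR, Matrix.vecMulVec_apply, hs (i + j) (by omega), pow_add]
  · convert hv.smul (sub_nonneg.2 ht.1) using 1
    ext i j
    simp only [hankelFplus, Matrix.of_apply, hs (i + j) (by omega), hs (i + j + 1) (by omega),
      Matrix.smul_apply, Matrix.vecMulVec_apply, star_trivial, smul_eq_mul]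
    ring
  · convert hv.smul (sub_nonneg.2 ht.2) using 1
    ext i j
    simp only [hankelFminus, Matrix.of_apply, hs (i + j) (by omega), hs (i + j + 1) (by omega),
      Matrix.smul_apply, Matrix.vecMulVec_apply, star_trivial, smul_eq_mul]
    ring

theorem powerSumSeq_pow (t : ℝ) {n k : ℕ} (hk : k ≤ n) :
    powerSumSeq (fun i : Fin n => t ^ ((i : ℕ) + 1)) k = t ^ k := by
  cases k with
  | zero => simp [powerSumSeq]
  | succ k => simp [powerSumSeq, show k < n by omega]

theorem powerSumSeq_convexCombination {n : ℕ} (x y : Fin n → ℝ) {α β : ℝ} (h : α + β = 1) :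
    powerSumSeq (α • x + β • y) = α • powerSumSeq x + β • powerSumSeq y := by
  funext k
  cases k with
  | zero => simp [powerSumSeq, h]
  | succ k => by_cases hk : k < n <;> simp [powerSumSeq, hk]

theorem hankelH_linear (m : ℕ) (s u : ℕ → ℝ) (a b α β : ℝ) :
    hankelH m (α • s + β • u) a b = α • hankelH m s a b + β • hankelH m u a b := by
  ext (i | i | i) (j | j | j) <;>
    simp [hankelH, hankelR, hankelFplus, hankelFminus] <;> ring

theorem momentFunctional_linear (s u : ℕ → ℝ) (α β : ℝ) (p : ℝ[X]) :
    momentFunctional (α • s + β • u) p = α * momentFunctional s p + β * momentFunctional u p := by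
  simp only [momentFunctional_eq_sum_range (Nat.lt_succ_self p.natDegree), Finset.mul_sum,
    ← Finset.sum_add_distrib, Pi.add_apply, Pi.smul_apply, smul_eq_mul]
  exact Finset.sum_congr rfl fun i _ => by ring

/-! ### Weak and strong duality -/

/-- As the zeroth moment is `1`, the constant coefficient joins the sum. -/
theorem sdp0Feasible_iff {Φ : ℕ → ℝ[X]} (hdeg : ∀ k, (Φ k).natDegree = k) {a b : ℝ} {m : ℕ}
    {y : ℝ} {x : Fin (2 * m - 1) → ℝ} :
    SDP0Feasible Φ a b m y x ↔
      (∀ k : Fin (2 * m - 1), -y ≤ momentFunctional (powerSumSeq x) (Φ (k + 1))) ∧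
        (hankelH m (powerSumSeq x) a b).PosSemidef := by
  have key : ∀ k, momentFunctional (powerSumSeq x) (Φ k) =
      (Φ k).coeff 0 + ∑ i ∈ Finset.Icc 1 k, (Φ k).coeff i * powerSumSeq x i := by
    intro k
    rw [momentFunctional_eq_sum_range (n := k + 1) (by rw [hdeg]; omega), Finset.sum_range_succ',
      add_comm, Finset.range_eq_Ico, Finset.sum_Ico_add' (fun i => (Φ k).coeff i * powerSumSeq x i)]
    simp only [powerSumSeq, mul_one, zero_add]
    rfl
  constructor
  · rintro ⟨h₁, h₂⟩
    refine ⟨fun k => ?_, h₂⟩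
    have := h₁ (k + 1) (Finset.mem_Icc.2 ⟨by omega, by omega⟩)
    rw [key]
    linarith
  · rintro ⟨h₁, h₂⟩
    refine ⟨fun k hk => ?_, h₂⟩
    rw [Finset.mem_Icc] at hk
    have := h₁ ⟨k - 1, by omega⟩
    simp only [Nat.sub_add_cancel hk.1] at this
    rw [key] at this
    linarith

/-- Weak duality. -/
theorem one_le_mul_sum_of_feasible {Φ : ℕ → ℝ[X]} (hdeg : ∀ k, (Φ k).natDegree = k) {a b : ℝ}
    (hab : a ≤ b) {m : ℕ} (hm : 1 ≤ m) {y : ℝ} {x : Fin (2 * m - 1) → ℝ}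
    (hx : SDP0Feasible Φ a b m y x) {f : Fin (2 * m - 1) → ℝ}
    (hf : LPFeasible Φ a b (2 * m - 1) f) : 1 ≤ y * ∑ k, f k := by
  obtain ⟨h₁, h₂⟩ := (sdp0Feasible_iff hdeg).1 hx
  set g : ℝ[X] := -1 - ∑ k, f k • Φ (k + 1) with hg
  have hgdeg : g.natDegree < 2 * m := by
    have : g.natDegree ≤ 2 * m - 1 := by
      refine (natDegree_sub_le _ _).trans (max_le (by simp) ?_)
      refine natDegree_sum_le_of_forall_le _ _ fun k _ => ?_
      exact (natDegree_smul_le _ _).trans (by rw [hdeg]; omega)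
    omega
  have hgnn := momentFunctional_nonneg hab rfl h₂ hgdeg fun t ht => by
    have := hf.le_neg_one t ht
    simp only [hg, eval_sub, eval_neg, eval_one, eval_finsetSum, eval_smul, smul_eq_mul]
    linarith
  have h1 : momentFunctional (powerSumSeq x) 1 = 1 := by
    rw [← pow_zero X, momentFunctional_X_pow]
    rfl
  rw [hg, map_sub, map_neg, h1, map_sum] at hgnn
  simp only [map_smul, smul_eq_mul] at hgnn
  have h₃ : ∑ k, f k * -y ≤ ∑ k, f k * momentFunctional (powerSumSeq x) (Φ (k + 1)) :=
    Finset.sum_le_sum fun k _ => mul_le_mul_of_nonneg_left (h₁ k) (hf.nonneg k)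
  rw [← Finset.sum_mul] at h₃
  linarith

/-- The moment vectors of the sequences satisfying the matrix inequality contain the convex hull of the curve
`t ↦ (Φ₁ t, …, Φₙ t)`. -/
theorem convexHull_curve_subset {Φ : ℕ → ℝ[X]} (hdeg : ∀ k, (Φ k).natDegree = k) {a b : ℝ} (m : ℕ) :
    convexHull ℝ ((fun t (k : Fin (2 * m - 1)) => (Φ (k + 1)).eval t) '' Set.Icc a b) ⊆
      {z | ∃ x : Fin (2 * m - 1) → ℝ, (hankelH m (powerSumSeq x) a b).PosSemidef ∧
        ∀ k, z k = momentFunctional (powerSumSeq x) (Φ (k + 1))} := by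
  refine convexHull_min ?_ ?_
  · rintro _ ⟨t, ht, rfl⟩
    refine ⟨fun i => t ^ ((i : ℕ) + 1),
      posSemidef_hankelH_pow ht fun k hk => powerSumSeq_pow t (by omega), fun k => ?_⟩
    have hk : (Φ (k + 1)).natDegree < 2 * m := by rw [hdeg]; omega
    rw [momentFunctional_eq_sum_range hk]
    refine (eval_eq_sum_range' hk t).trans ?_
    refine Finset.sum_congr rfl fun i hi => ?_
    rw [powerSumSeq_pow t (by rw [Finset.mem_range] at hi; omega)]
  · rintro z ⟨x, hx, hz⟩ w ⟨y, hy, hw⟩ α β hα hβ hαβ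
    refine ⟨α • x + β • y, ?_, fun k => ?_⟩
    · rw [powerSumSeq_convexCombination x y hαβ, hankelH_linear]
      exact (hx.smul hα).add (hy.smul hβ)
    · rw [powerSumSeq_convexCombination x y hαβ, momentFunctional_linear, ← hz, ← hw]
      rfl

/-- Ensures `y* < ⊤`, and through weak duality excludes LP-feasible points with sum `0`. -/
theorem exists_sdp0Feasible {Φ : ℕ → ℝ[X]} (hdeg : ∀ k, (Φ k).natDegree = k) {a b : ℝ}
    (hab : a ≤ b) (m : ℕ) : ∃ y x, SDP0Feasible Φ a b m y x := by
  obtain ⟨x, hx, -⟩ := convexHull_curve_subset hdeg m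
    (subset_convexHull ℝ _ ⟨a, Set.left_mem_Icc.2 hab, rfl⟩)
  refine ⟨∑ k : Fin (2 * m - 1), |momentFunctional (powerSumSeq x) (Φ (k + 1))|, x,
    (sdp0Feasible_iff hdeg).2 ⟨fun k => ?_, hx⟩⟩
  have := Finset.single_le_sum (f := fun k : Fin (2 * m - 1) =>
    |momentFunctional (powerSumSeq x) (Φ (k + 1))|) (fun _ _ => abs_nonneg _) (Finset.mem_univ k)
  have h₂ := neg_abs_le (momentFunctional (powerSumSeq x) (Φ (k + 1)))
  linarith

/-- A convex set disjoint from an open translate of the positive orthant is separated from it by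
a nonnegative functional. -/
theorem exists_nonneg_separating {ι : Type*} [Fintype ι] {K : Set (ι → ℝ)} (hK : Convex ℝ K)
    {y : ℝ} (hdisj : ∀ z ∈ K, ∃ k, z k ≤ -y) :
    ∃ (l : ι → ℝ) (u : ℝ), (∀ k, 0 ≤ l k) ∧ (∀ z ∈ K, ∑ k, l k * z k ≤ u) ∧
      ∀ c < y, u < -c * ∑ k, l k := by
  classical
  set Q : Set (ι → ℝ) := Set.univ.pi fun _ => Set.Ioi (-y) with hQ
  obtain ⟨F, u, hFQ, hFK⟩ := geometric_hahn_banach_open (s := Q) (t := K)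
    (convex_pi fun _ _ => convex_Ioi _) (isOpen_set_pi Set.finite_univ fun _ _ => isOpen_Ioi) hK
    (by
      rw [Set.disjoint_left]
      intro z hzQ hzK
      obtain ⟨k, hk⟩ := hdisj z hzK
      exact absurd (hzQ k trivial) (not_lt.2 hk))
  have hF : ∀ z, F z = ∑ k, z k * F (Pi.single k 1) := by
    intro z
    conv_lhs => rw [pi_eq_sum_univ' z]
    simp [map_sum]
  have hmem : ∀ c < y, (fun _ => -c : ι → ℝ) ∈ Q := fun c hc k _ => neg_lt_neg hc
  refine ⟨fun k => -F (Pi.single k 1), -u, fun k => ?_, fun z hz => ?_, fun c hc => ?_⟩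
  -- `Q` is stable under adding positive multiples of a basis vector, so a positive value of `F`
  -- there would make `F` unbounded above on `Q`.
  · by_contra! hneg
    have hpos : 0 < F (Pi.single k 1) := by linarith
    set z₀ : ι → ℝ := fun _ => -(y - 1)
    obtain ⟨n, hn⟩ := exists_nat_gt ((u - F z₀) / F (Pi.single k 1))
    rw [div_lt_iff₀ hpos] at hn
    have : F (z₀ + (n : ℝ) • Pi.single k 1) < u := by
      refine hFQ _ fun i _ => ?_
      have h₁ : 0 ≤ (n : ℝ) * (Pi.single k 1 : ι → ℝ) i :=
        mul_nonneg n.cast_nonneg (by rw [Pi.single_apply]; split_ifs <;> norm_num)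
      simp only [Set.mem_Ioi, Pi.add_apply, Pi.smul_apply, smul_eq_mul, z₀]
      linarith
    rw [map_add, map_smul, smul_eq_mul] at this
    linarith
  · have := hFK z hz
    rw [hF] at this
    have h₂ : ∑ k, -F (Pi.single k 1) * z k = -∑ k, z k * F (Pi.single k 1) := by
      rw [← Finset.sum_neg_distrib]
      exact Finset.sum_congr rfl fun k _ => by ring
    rw [h₂]
    linarith
  · have := hFQ _ (hmem c hc)
    rw [hF, ← Finset.mul_sum] at this
    rw [Finset.sum_neg_distrib]
    linarith

/-- Strong duality. -/
theorem exists_lpFeasible {Φ : ℕ → ℝ[X]} (hdeg : ∀ k, (Φ k).natDegree = k) {a b : ℝ}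
    (hab : a ≤ b) {m : ℕ} {c : ℝ} (hc : 0 < c) (hcv : (c : EReal) < sdp0Value Φ a b m) :
    ∃ f, LPFeasible Φ a b (2 * m - 1) f ∧ ∑ k, f k = c⁻¹ := by
  -- `y < y*` keeps the hull off the orthant; `c < y` makes the bound `u < -c * ∑ l k` strict.
  obtain ⟨y, hcy, hyv⟩ := EReal.lt_iff_exists_real_btwn.1 hcv
  rw [EReal.coe_lt_coe_iff] at hcy
  set curve : ℝ → Fin (2 * m - 1) → ℝ := fun t k => (Φ (k + 1)).eval t
  obtain ⟨l, u, hl, hlK, hlu⟩ := exists_nonneg_separating (y := y)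
    (convex_convexHull ℝ (curve '' Set.Icc a b)) (by
      intro z hz
      by_contra! hlt
      obtain ⟨x, hx, hzx⟩ := convexHull_curve_subset hdeg m hz
      refine absurd hyv (not_lt.2 (iInf₂_le y ⟨x, (sdp0Feasible_iff hdeg).2 ⟨fun k => ?_, hx⟩⟩))
      rw [← hzx]
      exact (hlt k).le)
  have hcurve : ∀ t ∈ Set.Icc a b, ∑ k, l k * (Φ (k + 1)).eval t ≤ u := fun t ht =>
    hlK (curve t) (subset_convexHull ℝ _ ⟨t, ht, rfl⟩)
  have huc := hlu c hcy
  have hSnn : 0 ≤ ∑ k, l k := Finset.sum_nonneg fun k _ => hl k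
  -- For `l = 0` the separation would read `0 ≤ u < 0`, the curve being nonempty.
  have hS : 0 < ∑ k, l k := by
    refine lt_of_le_of_ne hSnn fun h0 => ?_
    have hl0 : ∀ k, l k = 0 := fun k =>
      (Finset.sum_eq_zero_iff_of_nonneg fun k _ => hl k).1 h0.symm k (Finset.mem_univ k)
    have h₁ := hcurve a (Set.left_mem_Icc.2 hab)
    simp only [hl0, zero_mul, Finset.sum_const_zero, mul_zero] at h₁ huc
    linarith
  have hcS : 0 < c * ∑ k, l k := mul_pos hc hS
  refine ⟨fun k => l k / (c * ∑ k, l k), ⟨fun k => div_nonneg (hl k) hcS.le, fun t ht => ?_⟩, ?_⟩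
  · have h₁ := hcurve t ht
    have h₂ : ∑ k, l k / (c * ∑ k, l k) * (Φ (k + 1)).eval t =
        (∑ k, l k * (Φ (k + 1)).eval t) / (c * ∑ k, l k) := by
      rw [Finset.sum_div]
      exact Finset.sum_congr rfl fun k _ => by ring
    rw [h₂, div_le_iff₀ hcS]
    linarith
  · rw [← Finset.sum_div]
    field_simp

theorem sdp0BoundAt_eq_lpBoundAt {Φ : ℕ → ℝ[X]} (hdeg : ∀ k, (Φ k).natDegree = k) {a b : ℝ}
    (hab : a ≤ b) {m : ℕ} (hm : 1 ≤ m) :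
    sdp0BoundAt Φ a b m = lpBoundAt Φ a b (2 * m - 1) := by
  obtain ⟨y₀, x₀, hx₀⟩ := exists_sdp0Feasible (Φ := Φ) hdeg hab m
  have hle : ∀ f, LPFeasible Φ a b (2 * m - 1) f →
      0 < ∑ k, f k ∧ (((∑ k, f k)⁻¹ : ℝ) : EReal) ≤ sdp0Value Φ a b m := by
    intro f hf
    have hS : 0 < ∑ k, f k := by
      refine lt_of_le_of_ne (Finset.sum_nonneg fun k _ => hf.nonneg k) fun h0 => ?_
      have := one_le_mul_sum_of_feasible hdeg hab hm hx₀ hf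
      rw [← h0, mul_zero] at this
      linarith
    refine ⟨hS, le_iInf₂ fun y ⟨x, hx⟩ => ?_⟩
    rw [EReal.coe_le_coe_iff, inv_le_iff_one_le_mul₀ hS]
    exact one_le_mul_sum_of_feasible hdeg hab hm hx hf
  unfold sdp0BoundAt lpBoundAt
  split_ifs with hpos
  · have hlt : sdp0Value Φ a b m ≠ ⊤ :=
      ((iInf₂_le y₀ ⟨x₀, hx₀⟩).trans_lt (EReal.coe_lt_top y₀)).ne
    obtain ⟨v, hv⟩ : ∃ v : ℝ, sdp0Value Φ a b m = v :=
      ⟨_, (EReal.coe_toReal hlt (ne_bot_of_gt hpos)).symm⟩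
    rw [hv] at hpos hle ⊢
    have hv0 : 0 < v := EReal.coe_pos.1 hpos
    have hinf : ⨅ (f : Fin (2 * m - 1) → ℝ) (_ : LPFeasible Φ a b (2 * m - 1) f),
        ((∑ k, f k : ℝ) : EReal) = ((v⁻¹ : ℝ) : EReal) := by
      apply le_antisymm
      -- Every `r > 1/v` is the sum of an LP-feasible point, by strong duality at `c = 1/r`; the
      -- infimum need not be attained.
      · refine EReal.le_of_forall_lt_iff_le.1 fun r hr => ?_
        rw [EReal.coe_lt_coe_iff] at hr
        have hr0 : 0 < r := (inv_pos.2 hv0).trans hr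
        obtain ⟨f, hf, hfr⟩ := exists_lpFeasible hdeg hab (m := m) (inv_pos.2 hr0) (by
          rw [hv, EReal.coe_lt_coe_iff]
          exact inv_lt_of_inv_lt₀ hv0 hr)
        rw [inv_inv] at hfr
        exact (iInf₂_le f hf).trans_eq (by rw [hfr])
      · refine le_iInf₂ fun f hf => ?_
        obtain ⟨hS, h₁⟩ := hle f hf
        rw [EReal.coe_le_coe_iff] at h₁ ⊢
        exact inv_le_of_inv_le₀ hS h₁
    rw [hinf, ← EReal.coe_one, ← EReal.coe_add, ← EReal.coe_add, ← EReal.coe_div,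
      EReal.coe_eq_coe_iff]
    field_simp
    ring
  · have hempty : ∀ f, ¬ LPFeasible Φ a b (2 * m - 1) f := fun f hf =>
      hpos ((EReal.coe_pos.2 (inv_pos.2 (hle f hf).1)).trans_le (hle f hf).2)
    simp only [hempty, iInf_false, iInf_top]
    rw [← EReal.coe_one, EReal.coe_add_top]

/-! ### Infimum over the number of polynomials -/

/-- Feasible points of the linear program may be padded by zeros. -/
theorem LPFeasible.exists_succ {Φ : ℕ → ℝ[X]} {a b : ℝ} {N : ℕ} {f : Fin N → ℝ}
    (hf : LPFeasible Φ a b N f) : ∃ g, LPFeasible Φ a b (N + 1) g ∧ ∑ k, g k = ∑ k, f k := by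
  refine ⟨Fin.snoc f 0, ⟨fun k => ?_, fun t ht => ?_⟩, ?_⟩
  · refine Fin.lastCases ?_ (fun i => ?_) k
    · simp
    · simpa using hf.nonneg i
  · simpa [Fin.sum_univ_castSucc] using hf.le_neg_one t ht
  · simp [Fin.sum_univ_castSucc]

theorem LPFeasible.exists_of_le {Φ : ℕ → ℝ[X]} {a b : ℝ} {N M : ℕ} (hNM : N ≤ M) {f : Fin N → ℝ}
    (hf : LPFeasible Φ a b N f) : ∃ g, LPFeasible Φ a b M g ∧ ∑ k, g k = ∑ k, f k := by
  induction M, hNM using Nat.le_induction with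
  | base => exact ⟨f, hf, rfl⟩
  | succ M _ ih =>
    obtain ⟨g, hg, hgf⟩ := ih
    obtain ⟨g', hg', hgf'⟩ := hg.exists_succ
    exact ⟨g', hg', hgf'.trans hgf⟩

theorem iInf_lpBoundAt_odd (Φ : ℕ → ℝ[X]) (a b : ℝ) :
    ⨅ (m : ℕ) (_ : 1 ≤ m), lpBoundAt Φ a b (2 * m - 1) = lpBound Φ a b := by
  -- A real summand cancels in `EReal`, so the leading `1 +` can be moved across the infimum.
  have hcancel : ∀ u : EReal, ((-1 : ℝ) : EReal) + (1 + u) = u := by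
    intro u
    rw [← EReal.coe_one, ← add_assoc, ← EReal.coe_add]
    simp
  have hcancel' : ∀ u : EReal, 1 + (((-1 : ℝ) : EReal) + u) = u := by
    intro u
    rw [← EReal.coe_one, ← add_assoc, ← EReal.coe_add]
    simp
  apply le_antisymm
  · rw [← hcancel' (⨅ (m : ℕ) (_ : 1 ≤ m), lpBoundAt Φ a b (2 * m - 1))]
    refine add_le_add_right (le_iInf fun N => le_iInf₂ fun f hf => ?_) 1
    -- The choice `m = N + 1` meets `1 ≤ m` even for `N = 0`.
    obtain ⟨g, hg, hgf⟩ := hf.exists_of_le (show N ≤ 2 * (N + 1) - 1 by omega)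
    rw [← hgf, ← hcancel ((∑ k, g k : ℝ) : EReal)]
    refine add_le_add_right ?_ _
    exact (iInf₂_le (N + 1) (by omega)).trans (add_le_add_right (iInf₂_le g hg) 1)
  · exact le_iInf₂ fun m _ => add_le_add_right
      (iInf_le (fun N => ⨅ (f : Fin N → ℝ) (_ : LPFeasible Φ a b N f),
        ((∑ k, f k : ℝ) : EReal)) (2 * m - 1)) 1

end DelsarteSDP

theorem theorem4p2 (Φ : ℕ → Polynomial ℝ) (τ₀ a b : ℝ)
    (hdeg : ∀ k : ℕ, (Φ k).degree = (k : WithBot ℕ))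
    (hnorm : ∀ k : ℕ, (Φ k).eval τ₀ = 1)
    (hab : a ≤ b) :
    DelsarteSDP.sdp0Bound Φ a b = DelsarteSDP.lpBound Φ a b ∧
      ∀ m : ℕ, 1 ≤ m →
        DelsarteSDP.sdp0BoundAt Φ a b m = DelsarteSDP.lpBoundAt Φ a b (2 * m - 1) := by
  have hnat : ∀ k, (Φ k).natDegree = k := fun k => natDegree_eq_of_degree_eq_some (hdeg k)
  have hat : ∀ m : ℕ, 1 ≤ m →
      DelsarteSDP.sdp0BoundAt Φ a b m = DelsarteSDP.lpBoundAt Φ a b (2 * m - 1) :=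
    fun m hm => DelsarteSDP.sdp0BoundAt_eq_lpBoundAt hnat hab hm
  refine ⟨?_, hat⟩
  rw [← DelsarteSDP.iInf_lpBoundAt_odd]
  exact iInf_congr fun m => iInf_congr (hat m)
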